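/- Let $V$ be a vector space over a field $\mathbb F$. A series in $V$ is a set $\mathcal L$ of subspaces of $V$ that contains $0$ and $V$, is linearly ordered by inclusion, and is closed under arbitrary intersections and unions (with the conventions $\bigcap\emptyset=V$ and $\bigcup\emptyset=0$). A jump of $\mathcal L$ is a pair $(B,T)$ of elements of $\mathcal L$ with $B<T$ such that the only $U\in\mathcal L$ with $B\le U\le T$ are $B$ and $T$. The stability group of $\mathcal L$ is the subgroup $$S(\mathcal L)=\{g\in \mathrm{GL}(V)\mid (g-1)T\le B \text{ for every jump } (B,T) \text{ of } \mathcal L\}$$ of $\mathrm{GL}(V)$. The Hirsch–Plotkin radical of a group is the subgroup generated by all its normal locally nilpotent subgroups, where a group is locally nilpotent if all its finitely generated subgroups are nilpotent. An element $g$ of $\mathrm{GL}(V)$ is unipotent if $(g-1)^n=0$ in $\mathrm{End}(V)$ for some $n\in\mathbb N$. An element $g$ of a group $G$ is left Engel in $G$ if for every $x\in G$ there is an $n\in\mathbb N$ with $[x,{}_n g]=1$, where $[x,{}_0 g]=x$, $[x,{}_{n+1}g]=[[x,{}_n g],g]$ and $[a,b]=a^{-1}b^{-1}ab$. **Theorem.**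 For every vector space $V$ over a field and every series $\mathcal L$ in $V$: 1. every element of the Hirsch–Plotkin radical of $S(\mathcal L)$ is unipotent; 2. moreover, an element of $S(\mathcal L)$ that is not unipotent is not left Engel in $S(\mathcal L)$. -/

import Mathlib

section GroupTheory

variable (G : Type*) [Group G]

/-- A group is locally nilpotent if all its finitely generated subgroups are nilpotent. -/
def IsLocallyNilpotentGroup : Prop :=
  ∀ K : Subgroup G, K.FG → Group.IsNilpotent K

/-- The Hirsch–Plotkin radical of a group: the subgroup generated by all its normal locally
nilpotent subgroups. -/
def hirschPlotkinRadical : Subgroup G :=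
  sSup {N : Subgroup G | N.Normal ∧ IsLocallyNilpotentGroup N}

variable {G}

/-- The iterated commutator `[x, g, …, g]` with `n` entries `g`, where `[a, b] = a⁻¹ b⁻¹ a b`. -/
def iterComm (x g : G) : ℕ → G
  | 0 => x
  | n + 1 => (iterComm x g n)⁻¹ * g⁻¹ * iterComm x g n * g

/-- `g` is a left Engel element of `G` if for every `x` in `G` there is an `n` such that
`[x, g, …, g] = 1`, with `n` entries `g`. -/
def IsLeftEngel (g : G) : Prop :=
  ∀ x : G, ∃ n : ℕ, iterComm x g n = 1

end GroupTheory

section Series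

variable {F V : Type*} [Field F] [AddCommGroup V] [Module F V]

/-- A series in `V`: a chain of subspaces that contains `0` and `V` and is closed under
arbitrary intersections and unions. As the members form a chain, the supremum `sSup 𝓕` is the
union of `𝓕` (see `IsSeries.mem_sSup_iff`). -/
structure IsSeries (L : Set (Submodule F V)) : Prop where
  bot_mem : ⊥ ∈ L
  top_mem : ⊤ ∈ L
  chain : IsChain (· ≤ ·) L
  sInf_mem : ∀ 𝓕 ⊆ L, sInf 𝓕 ∈ L
  sSup_mem : ∀ 𝓕 ⊆ L, sSup 𝓕 ∈ L

theorem IsSeries.mem_sSup_iff {L : Set (Submodule F V)} (hL : IsSeries L)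
    {𝓕 : Set (Submodule F V)} (h𝓕 : 𝓕 ⊆ L) (hne : 𝓕.Nonempty) (v : V) :
    v ∈ sSup 𝓕 ↔ ∃ W ∈ 𝓕, v ∈ W :=
  Submodule.mem_sSup_of_directed hne (hL.chain.mono h𝓕).directedOn

/-- `(B, T)` is a jump of `L`: `B < T` are consecutive members of `L`. -/
structure IsJump (L : Set (Submodule F V)) (B T : Submodule F V) : Prop where
  bot_mem : B ∈ L
  top_mem : T ∈ L
  lt : B < T
  eq_or_eq : ∀ U ∈ L, B ≤ U → U ≤ T → U = B ∨ U = T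

/-- Every vector outside a member `T` of the series lies in the upper, but not in the lower,
term of a jump whose lower term contains `T`. -/
theorem IsSeries.exists_jump {L : Set (Submodule F V)} (hL : IsSeries L) {T : Submodule F V}
    (hT : T ∈ L) {w : V} (hw : w ∉ T) :
    ∃ B' T', IsJump L B' T' ∧ T ≤ B' ∧ w ∈ T' ∧ w ∉ B' := by
  have h1 : {U | U ∈ L ∧ w ∉ U} ⊆ L := fun U hU => hU.1
  have h2 : {U | U ∈ L ∧ w ∈ U} ⊆ L := fun U hU => hU.1
  have hB : w ∉ sSup {U | U ∈ L ∧ w ∉ U} := by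
    rw [hL.mem_sSup_iff h1 ⟨T, hT, hw⟩]
    rintro ⟨W, hW, hwW⟩
    exact hW.2 hwW
  have hT' : w ∈ sInf {U | U ∈ L ∧ w ∈ U} := by
    rw [Submodule.mem_sInf]
    exact fun U hU => hU.2
  refine ⟨_, _, ⟨hL.sSup_mem _ h1, hL.sInf_mem _ h2, ?_, ?_⟩, le_sSup ⟨hT, hw⟩, hT', hB⟩
  · rcases hL.chain.total (hL.sSup_mem _ h1) (hL.sInf_mem _ h2) with h | h
    · exact lt_of_le_of_ne h fun e => hB (e ▸ hT')
    · exact absurd (h hT') hB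
  · intro U hU hBU hUT
    by_cases hwU : w ∈ U
    · exact Or.inr (le_antisymm hUT (sInf_le ⟨hU, hwU⟩))
    · exact Or.inl (le_antisymm (le_sSup ⟨hU, hwU⟩) hBU)

/-- The stability group of a series: all `g` in `GL(V)` with `[T, g] ≤ B` for each jump
`(B, T)`, where `[T, g]` is the image of `T` under `g - 1`. -/
def stabilityGroup {L : Set (Submodule F V)} (hL : IsSeries L) :
    Subgroup (LinearMap.GeneralLinearGroup F V) where
  carrier := {g | ∀ B T, IsJump L B T → T.map ((g : Module.End F V) - 1) ≤ B}
  one_mem' := by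
    intro B T _
    simp
  mul_mem' := by
    intro g h hg hh B T hJ
    rw [Submodule.map_le_iff_le_comap]
    intro v hv
    have e1 : (h : Module.End F V) v - v ∈ B := hh B T hJ (Submodule.mem_map_of_mem hv)
    have hv' : (h : Module.End F V) v ∈ T := by
      simpa using T.add_mem (hJ.lt.le e1) hv
    have e2 : (g : Module.End F V) ((h : Module.End F V) v) - (h : Module.End F V) v ∈ B :=
      hg B T hJ (Submodule.mem_map_of_mem hv')
    simpa using B.add_mem e2 e1
  inv_mem' := by
    intro g hg B T hJ
    rw [Submodule.map_le_iff_le_comap]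
    intro v hv
    obtain ⟨w, hw⟩ : ∃ w, w = ((g⁻¹ : LinearMap.GeneralLinearGroup F V) : Module.End F V) v :=
      ⟨_, rfl⟩
    have hgw : (g : Module.End F V) w = v := by
      rw [hw, ← Module.End.mul_apply, Units.mul_inv, Module.End.one_apply]
    have hwT : w ∈ T := by
      by_contra hwT
      obtain ⟨B', T', hJ', hTB, hwT', hwB⟩ := hL.exists_jump hJ.top_mem hwT
      have e : (g : Module.End F V) w - w ∈ B' := hg B' T' hJ' (Submodule.mem_map_of_mem hwT')
      rw [hgw] at e
      exact hwB (by simpa using B'.sub_mem (hTB hv) e)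
    have e : (g : Module.End F V) w - w ∈ B := hg B T hJ (Submodule.mem_map_of_mem hwT)
    rw [hgw] at e
    have e' := B.neg_mem e
    rw [neg_sub, hw] at e'
    exact e'

/-- `g` is unipotent if `(g - 1) ^ n = 0` in `End(V)` for some `n`. -/
def IsUnipotentElement (g : LinearMap.GeneralLinearGroup F V) : Prop :=
  ∃ n : ℕ, ((g : Module.End F V) - 1) ^ n = 0

end Series

/-! By the Hirsch–Plotkin theorem, an element of the radical lies in a normal locally nilpotent
subgroup `N`. Since `[x, g] ∈ N` for every `x`, such an element is left Engel, so everything reduces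
to `IsLeftEngel.isUnipotentElement`.

Let `g` be left Engel and `h = g - 1`. The test elements are `x = 1 + ν`, where `ν` maps `V` into a
`g`-invariant subspace `K` and kills `K`. Then `[x, g, …, g] = 1 + δⁿν` with `δν = g⁻¹νg - ν`
(`coe_iterComm`), so `δⁿν = 0` for some `n`. Rank one choices of `ν` show that `h` is nilpotent on
`V / T` for each jump `(B, T)`, which settles the case `B = 0`, and that `h` is locally nilpotent on
`V`. If no jump starts at `0` and `h` is not nilpotent, an infinite sum `ν = ∑ φ i (·) • v i`, built
along a descending sequence in the series, satisfies `δⁿν = ν hⁿ ≠ 0` for all `n`, a contradiction.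
-/

/-! ### Fitting's theorem and finitely generated normal closures -/

namespace Subgroup

open scoped commutatorElement

variable {G : Type*} [Group G]

theorem isNilpotent_of_le {H K : Subgroup G} (h : H ≤ K) (hK : Group.IsNilpotent K) :
    Group.IsNilpotent H := by
  rw [isNilpotent_iff_lowerCentralSeries] at hK ⊢
  obtain ⟨n, hn⟩ := hK
  exact ⟨n, le_bot_iff.1 (hn ▸ lowerCentralSeries_mono n h)⟩

/-- The right side bounds `A` by a fixed subgroup, so the condition passes to joins. -/
theorem commutator_le_iff_le_comap_centralizer (A B X : Subgroup G) [X.Normal] :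
    ⁅A, B⁆ ≤ X ↔
      A ≤ (centralizer (B.map (QuotientGroup.mk' X) : Set (G ⧸ X))).comap (QuotientGroup.mk' X) := by
  rw [← map_le_iff_le_comap, ← commutator_eq_bot_iff_le_centralizer, ← map_commutator,
    map_eq_bot_iff, QuotientGroup.ker_mk']

theorem iSup_commutator_le {ι : Sort*} {A : ι → Subgroup G} {B X : Subgroup G} [X.Normal]
    (h : ∀ i, ⁅A i, B⁆ ≤ X) : ⁅⨆ i, A i, B⁆ ≤ X := by
  rw [commutator_le_iff_le_comap_centralizer]
  exact iSup_le fun i => (commutator_le_iff_le_comap_centralizer _ _ _).1 (h i)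

theorem commutator_sup_le {A M N X : Subgroup G} [X.Normal] (hM : ⁅A, M⁆ ≤ X) (hN : ⁅A, N⁆ ≤ X) :
    ⁅A, M ⊔ N⁆ ≤ X := by
  rw [commutator_comm, commutator_le_iff_le_comap_centralizer] at *
  exact sup_le hM hN

/-- The lower central series of `M`, preceded by the whole group. -/
def extendedLowerCentralSeries (M : Subgroup G) : ℕ → Subgroup G
  | 0 => ⊤
  | n + 1 => M.lowerCentralSeries n

instance (M : Subgroup G) [M.Normal] (n : ℕ) : (M.extendedLowerCentralSeries n).Normal := by
  cases n with
  | zero => exact inferInstanceAs (⊤ : Subgroup G).Normal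
  | succ n => exact inferInstanceAs (M.lowerCentralSeries n).Normal

theorem extendedLowerCentralSeries_commutator_le (M : Subgroup G) [M.Normal] (n : ℕ) :
    ⁅M.extendedLowerCentralSeries n, M⁆ ≤ M.extendedLowerCentralSeries (n + 1) := by
  cases n with
  | zero => exact commutator_le_right _ _
  | succ n => exact le_rfl

/-- Fitting's theorem for two normal subgroups that generate the group. -/
theorem isNilpotent_of_normal_of_sup_eq_top {M N : Subgroup G} [M.Normal] [N.Normal]
    (hM : Group.IsNilpotent M) (hN : Group.IsNilpotent N) (h : M ⊔ N = ⊤) :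
    Group.IsNilpotent G := by
  rw [isNilpotent_iff_lowerCentralSeries] at hM hN
  obtain ⟨m, hm⟩ := hM
  obtain ⟨n, hn⟩ := hN
  -- A commutator with `M` raises the first index and one with `N` the second; normality keeps the
  -- other index.
  have key : ∀ k, (⊤ : Subgroup G).lowerCentralSeries k ≤ ⨆ p : {p : ℕ × ℕ // p.1 + p.2 = k},
      M.extendedLowerCentralSeries p.1.1 ⊓ N.extendedLowerCentralSeries p.1.2 := by
    intro k
    induction k with
    | zero =>
      refine le_trans ?_ (le_iSup _ ⟨(0, 0), rfl⟩)
      exact le_inf le_rfl le_rfl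
    | succ k ih =>
      refine (commutator_mono ih le_rfl).trans (iSup_commutator_le ?_)
      rintro ⟨⟨i, j⟩, hij⟩
      rw [← h]
      refine commutator_sup_le ?_ ?_
      · refine le_trans ?_ (le_iSup _ ⟨(i + 1, j), by simp only at hij ⊢; omega⟩)
        exact le_inf ((commutator_mono inf_le_left le_rfl).trans
          (extendedLowerCentralSeries_commutator_le M i))
          ((commutator_mono inf_le_right le_rfl).trans (commutator_le_left _ _))
      · refine le_trans ?_ (le_iSup _ ⟨(i, j + 1), by simp only at hij ⊢; omega⟩)
        exact le_inf ((commutator_mono inf_le_left le_rfl).trans (commutator_le_left _ _))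
          ((commutator_mono inf_le_right le_rfl).trans
          (extendedLowerCentralSeries_commutator_le N j))
  rw [nilpotent_iff_lowerCentralSeries]
  refine ⟨m + n + 2, le_bot_iff.1 ((key _).trans (iSup_le ?_))⟩
  rintro ⟨⟨i, j⟩, hij⟩
  simp only at hij ⊢
  rcases (by omega : m + 1 ≤ i ∨ n + 1 ≤ j) with hi | hj
  · obtain ⟨i, rfl⟩ : ∃ i', i = i' + 1 := ⟨i - 1, by omega⟩
    exact inf_le_left.trans ((M.lowerCentralSeries_antitone (by omega : m ≤ i)).trans hm.le)
  · obtain ⟨j, rfl⟩ : ∃ j', j = j' + 1 := ⟨j - 1, by omega⟩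
    exact inf_le_right.trans ((N.lowerCentralSeries_antitone (by omega : n ≤ j)).trans hn.le)

/-- Fitting's theorem: two nilpotent subgroups that normalize each other generate a nilpotent
subgroup. -/
theorem isNilpotent_sup {M N : Subgroup G} (hM : Group.IsNilpotent M) (hN : Group.IsNilpotent N)
    (hMN : M ≤ normalizer N) (hNM : N ≤ normalizer M) : Group.IsNilpotent ↥(M ⊔ N) := by
  have h1 : (M.subgroupOf (M ⊔ N)).Normal :=
    (normal_subgroupOf_iff_le_normalizer le_sup_left).2 (sup_le le_normalizer hNM)
  have h2 : (N.subgroupOf (M ⊔ N)).Normal :=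
    (normal_subgroupOf_iff_le_normalizer le_sup_right).2 (sup_le hMN le_normalizer)
  refine isNilpotent_of_normal_of_sup_eq_top (M := M.subgroupOf (M ⊔ N))
    (N := N.subgroupOf (M ⊔ N)) ?_ ?_ ?_
  · exact (Group.isNilpotent_congr (subgroupOfEquivOfLe le_sup_left)).2 hM
  · exact (Group.isNilpotent_congr (subgroupOfEquivOfLe le_sup_right)).2 hN
  · rw [← subgroupOf_sup le_sup_left le_sup_right, subgroupOf_self]

theorem closure_le_normalizer_closure {S D : Set G} (hS : ∀ s ∈ S, s⁻¹ ∈ S)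
    (h : ∀ s ∈ S, ∀ d ∈ D, s * d * s⁻¹ ∈ closure D) : closure S ≤ normalizer (closure D) := by
  have key : ∀ s ∈ S, ∀ d ∈ closure D, s * d * s⁻¹ ∈ closure D := by
    intro s hs d hd
    have : closure D ≤ (closure D).comap (MulAut.conj s).toMonoidHom :=
      (closure_le _).2 fun d hd => by simpa using! h s hs d hd
    simpa using! this hd
  refine (closure_le _).2 fun s hs => mem_normalizer_iff.2 fun d => ⟨key s hs d, fun hd => ?_⟩
  simpa [mul_assoc] using key _ (hS s hs) _ hd

/-- In a nilpotent group generated by `S ∪ C` with `C` finite, the normal closure of `C` under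
`S` is finitely generated. -/
theorem exists_finite_conj_mem_closure {S C : Set G} (hS : S.Finite) (hC : C.Finite)
    (hn : Group.IsNilpotent (closure (S ∪ C))) (K : Subgroup G) [K.Normal] (hCK : C ⊆ K) :
    ∃ D : Set G, D.Finite ∧ C ⊆ D ∧ D ⊆ K ∧ D ⊆ closure (S ∪ C) ∧
      ∀ s ∈ S, ∀ d ∈ D, s * d * s⁻¹ ∈ closure D := by
  obtain ⟨n, hn⟩ := (isNilpotent_iff_lowerCentralSeries _).1 hn
  -- `E k` consists of the commutators `[c, s₁, …, sₖ]`; those with `k = n` are trivial. Conjugation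
  -- stays in the span because `s d s⁻¹ = [d, s]⁻¹ d`.
  let E : ℕ → Set G := fun k => Nat.rec C (fun _ E => Set.image2 (fun c s => ⁅c, s⁆) E S) k
  have E_succ : ∀ k, E (k + 1) = Set.image2 (fun c s => ⁅c, s⁆) (E k) S := fun k => rfl
  have E_fin : ∀ k, (E k).Finite := by
    intro k
    induction k with
    | zero => exact hC
    | succ k ih => exact ih.image2 _ hS
  have E_K : ∀ k, E k ⊆ K := by
    intro k
    induction k with
    | zero => exact hCK
    | succ k ih =>
      rw [E_succ, Set.image2_subset_iff]
      intro c hc s _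
      exact commutator_le_left K ⊤ (commutator_mem_commutator (ih hc) (mem_top s))
  have E_lcs : ∀ k, E k ⊆ (closure (S ∪ C)).lowerCentralSeries k := by
    intro k
    induction k with
    | zero => exact fun c hc => subset_closure (Or.inr hc)
    | succ k ih =>
      rw [E_succ, Set.image2_subset_iff]
      intro c hc s hs
      exact commutator_mem_commutator (ih hc) (subset_closure (Or.inl hs))
  refine ⟨⋃ k ∈ Set.Iic n, E k, (Set.finite_Iic n).biUnion fun k _ => E_fin k,
    Set.subset_biUnion_of_mem (u := E) (show 0 ∈ Set.Iic n from Nat.zero_le n),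
    Set.iUnion₂_subset fun k _ => E_K k,
    Set.iUnion₂_subset fun k _ => (E_lcs k).trans (lowerCentralSeries_le_self _ k), ?_⟩
  intro s hs d hd
  obtain ⟨k, hk, hdk⟩ := Set.mem_iUnion₂.1 hd
  rcases lt_or_eq_of_le (show k ≤ n from hk) with hk | rfl
  · have h1 : ⁅d, s⁆ ∈ ⋃ k ∈ Set.Iic n, E k :=
      Set.mem_biUnion (show k + 1 ∈ Set.Iic n from hk) (Set.mem_image2_of_mem hdk hs)
    have h2 : s * d * s⁻¹ = ⁅d, s⁆⁻¹ * d := by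
      rw [commutatorElement_inv, commutatorElement_def]; group
    rw [h2]
    exact mul_mem (inv_mem (subset_closure h1)) (subset_closure hd)
  · have h1 : d = 1 := by
      have := E_lcs k hdk
      rw [hn] at this
      exact this
    simp [h1]

end Subgroup

/-! ### The Hirsch–Plotkin theorem and left Engel elements -/

section LocallyNilpotent

open Subgroup
open scoped commutatorElement

variable {G : Type*} [Group G]

theorem isLocallyNilpotentGroup_iff (N : Subgroup G) :
    IsLocallyNilpotentGroup N ↔ ∀ K ≤ N, K.FG → Group.IsNilpotent K := by
  constructor
  · intro h K hKN hK
    have e := subgroupOfEquivOfLe hKN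
    refine (Group.isNilpotent_congr e).1 (h _ ?_)
    rw [← Group.fg_iff_subgroup_fg] at hK ⊢
    exact Group.fg_of_surjective (f := e.symm.toMonoidHom) e.symm.surjective
  · intro h K hK
    have e := K.equivMapOfInjective N.subtype N.subtype_injective
    refine (Group.isNilpotent_congr e).2 (h _ (map_subtype_le K) ?_)
    rw [← Group.fg_iff_subgroup_fg] at hK ⊢
    exact Group.fg_of_surjective (f := e.toMonoidHom) e.surjective

theorem IsLocallyNilpotentGroup.closure {N : Subgroup G} (h : IsLocallyNilpotentGroup N)
    {S : Set G} (hS : S.Finite) (hSN : S ⊆ N) : Group.IsNilpotent (closure S) :=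
  (isLocallyNilpotentGroup_iff N).1 h _ ((closure_le _).2 hSN)
    ((fg_iff _).2 ⟨S, rfl, hS⟩)

/-- If two finite symmetric sets lie in normal locally nilpotent subgroups, then they generate
a nilpotent subgroup. -/
theorem isNilpotent_closure_sup_closure {M N : Subgroup G} [M.Normal] [N.Normal]
    (hM : IsLocallyNilpotentGroup M) (hN : IsLocallyNilpotentGroup N) {X Y : Set G}
    (hX : X.Finite) (hY : Y.Finite) (hXM : X ⊆ M) (hYN : Y ⊆ N) (hX' : ∀ x ∈ X, x⁻¹ ∈ X)
    (hY' : ∀ y ∈ Y, y⁻¹ ∈ Y) : Group.IsNilpotent ↥(closure X ⊔ closure Y) := by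
  let C : Set G := Set.image2 (fun x y => ⁅x, y⁆) X Y
  have hC : C.Finite := hX.image2 _ hY
  have hC' : C ⊆ (M ⊓ N : Subgroup G) := by
    rw [Set.image2_subset_iff]
    exact fun x hx y hy => commutator_le_inf _ _ (commutator_mem_commutator (hXM hx) (hYN hy))
  have hCM : C ⊆ M := fun c hc => (hC' hc).1
  have hCN : C ⊆ N := fun c hc => (hC' hc).2
  -- `⟨D, Y⟩ ≤ N` and `⟨E, X⟩ ≤ M` are nilpotent. They normalize each other because `D` and `E`
  -- absorb the commutators of `X` and `Y`, `E ⊆ ⟨D, Y⟩` and `D ⊆ ⟨E, X⟩`; Fitting's theorem then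
  -- applies.
  obtain ⟨D, hD, hCD, hDN, hDX, hXD⟩ := exists_finite_conj_mem_closure hX hC
    (hM.closure (hX.union hC) (Set.union_subset hXM hCM)) N hCN
  obtain ⟨E, hE, hCE, hEM, hEY, hYE⟩ := exists_finite_conj_mem_closure hY hC
    (hN.closure (hY.union hC) (Set.union_subset hYN hCN)) M hCM
  have hQ := hN.closure (hD.union hY) (Set.union_subset hDN hYN)
  have hR := hM.closure (hE.union hX) (Set.union_subset hEM hXM)
  have hXQ : closure X ≤ normalizer (closure (D ∪ Y)) := by
    refine closure_le_normalizer_closure hX' fun x hx => ?_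
    rintro d (hd | hd)
    · exact closure_mono Set.subset_union_left (hXD x hx d hd)
    · have h1 : ⁅x, d⁆ ∈ D := hCD (Set.mem_image2_of_mem hx hd)
      rw [show x * d * x⁻¹ = ⁅x, d⁆ * d by rw [commutatorElement_def]; group]
      exact mul_mem (subset_closure (Or.inl h1)) (subset_closure (Or.inr hd))
  have hYR : closure Y ≤ normalizer (closure (E ∪ X)) := by
    refine closure_le_normalizer_closure hY' fun y hy => ?_
    rintro d (hd | hd)
    · exact closure_mono Set.subset_union_left (hYE y hy d hd)
    · have h1 : ⁅d, y⁆ ∈ E := hCE (Set.mem_image2_of_mem hd hy)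
      rw [show y * d * y⁻¹ = ⁅d, y⁆⁻¹ * d by
        rw [commutatorElement_inv, commutatorElement_def]; group]
      exact mul_mem (inv_mem (subset_closure (Or.inl h1))) (subset_closure (Or.inr hd))
  have hEQ : closure E ≤ closure (D ∪ Y) := (closure_le _).2 (hEY.trans ((closure_le _).2
    (Set.union_subset (fun y hy => subset_closure (Or.inr hy))
      fun c hc => subset_closure (Or.inl (hCD hc)))))
  have hDR : closure D ≤ closure (E ∪ X) := (closure_le _).2 (hDX.trans ((closure_le _).2
    (Set.union_subset (fun y hy => subset_closure (Or.inr hy))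
      fun c hc => subset_closure (Or.inl (hCE hc)))))
  refine isNilpotent_of_le ?_ (isNilpotent_sup hR hQ ?_ ?_)
  · exact sup_le_sup (closure_mono Set.subset_union_right) (closure_mono Set.subset_union_right)
  · rw [closure_union E X]
    exact sup_le (hEQ.trans le_normalizer) hXQ
  · rw [closure_union D Y]
    exact sup_le (hDR.trans le_normalizer) hYR

/-- The Hirsch–Plotkin theorem: the product of two normal locally nilpotent subgroups is locally
nilpotent. -/
theorem IsLocallyNilpotentGroup.sup {M N : Subgroup G} [M.Normal] [N.Normal]
    (hM : IsLocallyNilpotentGroup M) (hN : IsLocallyNilpotentGroup N) :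
    IsLocallyNilpotentGroup ↥(M ⊔ N) := by
  rw [isLocallyNilpotentGroup_iff]
  intro K hK hfg
  obtain ⟨T, rfl, hT⟩ := (fg_iff _).1 hfg
  have hT' : ∀ t : T, ∃ a ∈ M, ∃ b ∈ N, a * b = t := fun t =>
    mem_sup_of_normal_right.1 (hK (subset_closure t.2))
  choose a ha b hb hab using hT'
  have := hT.to_subtype
  have hX := Set.finite_range a
  have hY := Set.finite_range b
  refine isNilpotent_of_le ?_ (isNilpotent_closure_sup_closure hM hN
    (X := Set.range a ∪ (Set.range a)⁻¹) (Y := Set.range b ∪ (Set.range b)⁻¹)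
    (hX.union hX.inv) (hY.union hY.inv) ?_ ?_ ?_ ?_)
  · refine (closure_le _).2 fun t ht => ?_
    rw [← show a ⟨t, ht⟩ * b ⟨t, ht⟩ = t from hab ⟨t, ht⟩]
    exact mul_mem_sup (subset_closure (Or.inl ⟨_, rfl⟩)) (subset_closure (Or.inl ⟨_, rfl⟩))
  · rintro x (⟨t, rfl⟩ | ⟨t, ht⟩)
    · exact ha t
    · exact inv_mem_iff.1 (ht ▸ ha t)
  · rintro x (⟨t, rfl⟩ | ⟨t, ht⟩)
    · exact hb t
    · exact inv_mem_iff.1 (ht ▸ hb t)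
  · rintro x (hx | hx)
    · exact Or.inr (by simpa using hx)
    · exact Or.inl hx
  · rintro x (hx | hx)
    · exact Or.inr (by simpa using hx)
    · exact Or.inl hx

theorem mem_hirschPlotkinRadical_iff {g : G} : g ∈ hirschPlotkinRadical G ↔
    ∃ N : Subgroup G, (N.Normal ∧ IsLocallyNilpotentGroup N) ∧ g ∈ N := by
  rw [hirschPlotkinRadical, mem_sSup_of_directedOn]
  · rfl
  · refine ⟨⊥, inferInstance, fun K _ => ?_⟩
    infer_instance
  · rintro M ⟨hM, hM'⟩ N ⟨hN, hN'⟩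
    exact ⟨M ⊔ N, ⟨inferInstance, hM'.sup hN'⟩, le_sup_left, le_sup_right⟩

theorem iterComm_mem_lowerCentralSeries {H : Subgroup G} {x g : G} (hx : x ∈ H) (hg : g ∈ H)
    (n : ℕ) : iterComm x g n ∈ H.lowerCentralSeries n := by
  induction n with
  | zero => exact hx
  | succ n ih =>
    have h : iterComm x g (n + 1) = ⁅(iterComm x g n)⁻¹, g⁻¹⁆ := by
      rw [commutatorElement_def, inv_inv, inv_inv]; rfl
    rw [h]
    exact commutator_mem_commutator (inv_mem ih) (inv_mem hg)

theorem iterComm_succ_left (x g : G) (n : ℕ) :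
    iterComm x g (n + 1) = iterComm (iterComm x g 1) g n := by
  induction n with
  | zero => rfl
  | succ n ih => rw [iterComm, ih]; rfl

theorem isLeftEngel_of_mem_hirschPlotkinRadical {g : G} (hg : g ∈ hirschPlotkinRadical G) :
    IsLeftEngel g := by
  obtain ⟨N, ⟨hN, hN'⟩, hgN⟩ := mem_hirschPlotkinRadical_iff.1 hg
  intro x
  -- `x` need not lie in `N`, but `[x, g]` does; this costs one extra commutator.
  have hy : iterComm x g 1 ∈ N := by
    have h : iterComm x g 1 = (x⁻¹ * g⁻¹ * x⁻¹⁻¹) * g := by rw [inv_inv]; rfl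
    rw [h]
    exact mul_mem (hN.conj_mem _ (inv_mem hgN) _) hgN
  have h := hN'.closure (S := {iterComm x g 1, g}) (Set.toFinite _)
    (Set.insert_subset hy (Set.singleton_subset_iff.2 hgN))
  obtain ⟨n, hn⟩ := (isNilpotent_iff_lowerCentralSeries _).1 h
  refine ⟨n + 1, ?_⟩
  have := iterComm_mem_lowerCentralSeries (H := Subgroup.closure {iterComm x g 1, g})
    (subset_closure (Set.mem_insert _ _)) (subset_closure (Set.mem_insert_of_mem _ rfl)) n
  rw [hn] at this
  rw [iterComm_succ_left]
  exact this

end LocallyNilpotent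

/-! ### Independent sequences and functionals -/

section Functionals

variable {F M : Type*} [Field F] [AddCommGroup M] [Module F M]

/-- In a relation, the term of least index with nonzero coefficient would lie in the next subspace.
-/
theorem linearIndependent_of_notMem_succ {v : ℕ → M} {B : ℕ → Submodule F M} (hB : Antitone B)
    (hv : ∀ i, v i ∈ B i) (hv' : ∀ i, v i ∉ B (i + 1)) : LinearIndependent F v := by
  rw [linearIndependent_iff']
  intro s c hs i
  induction i using Nat.strong_induction_on with
  | _ i ih =>
    intro hi
    by_contra hc
    have h1 : ∑ j ∈ s.erase i, c j • v j ∈ B (i + 1) := by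
      refine Submodule.sum_mem _ fun j hj => ?_
      obtain ⟨hji, hj⟩ := Finset.mem_erase.1 hj
      rcases lt_or_gt_of_ne hji with h | h
      · rw [ih j h hj, zero_smul]
        exact Submodule.zero_mem _
      · exact Submodule.smul_mem _ _ (hB h (hv j))
    rw [← Finset.add_sum_erase s _ hi] at hs
    have h2 : c i • v i ∈ B (i + 1) := by
      rw [eq_neg_of_add_eq_zero_left hs]
      exact Submodule.neg_mem _ h1
    exact hv' i ((Submodule.smul_mem_iff _ hc).1 h2)

/-- A descending sequence of nonzero subspaces has a functional that vanishes on none of them. -/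
theorem exists_dual_forall_exists_apply_ne_zero {W : ℕ → Submodule F M} (hW : Antitone W)
    (hW0 : ∀ n, W n ≠ ⊥) : ∃ φ : Module.Dual F M, ∀ n, ∃ w ∈ W n, φ w ≠ 0 := by
  by_cases hinf : ∃ w, w ≠ 0 ∧ ∀ n, w ∈ W n
  · obtain ⟨w, hw, hwW⟩ := hinf
    obtain ⟨φ, hφ, -⟩ := Submodule.exists_le_ker_of_notMem (K := F) (p := ⊥) (v := w) (by simpa)
    exact ⟨φ, fun n => ⟨w, hwW n, hφ⟩⟩
  · push Not at hinf
    choose c hcW hc0 using fun n => Submodule.exists_mem_ne_zero_of_ne_bot (hW0 n)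
    choose N hN using fun n => hinf (c n) (hc0 n)
    -- Each index is followed by one whose subspace omits the chosen vector. The vectors `c (k i)`
    -- are then independent, and a functional can take the value `1` on all of them.
    let k : ℕ → ℕ := fun i => Nat.rec 0 (fun _ k => N k) i
    have hk : StrictMono k := strictMono_nat_of_lt_succ fun i => by
      by_contra hle
      exact hN (k i) (hW (not_lt.1 hle) (hcW (k i)))
    have hli : LinearIndependent F fun i => c (k i) :=
      linearIndependent_of_notMem_succ (B := fun i => W (k i)) (hW.comp_monotone hk.monotone)
        (fun i => hcW _) (fun i => hN (k i))
    obtain ⟨f, hf⟩ := LinearMap.exists_leftInverse_of_injective _ (LinearMap.ker_eq_bot.2 hli)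
    have hf' : ∀ i, f (c (k i)) = Finsupp.single i 1 := fun i => by
      simpa using LinearMap.congr_fun hf (Finsupp.single i 1)
    refine ⟨Finsupp.linearCombination F (fun _ => (1 : F)) ∘ₗ f, fun n =>
      ⟨c (k n), hW hk.le_apply (hcW _), ?_⟩⟩
    simp [hf']

end Functionals

/-! ### Test elements `1 + ν`, and unipotence above a jump -/

section Unipotent

variable {F V : Type*} [Field F] [AddCommGroup V] [Module F V]

/-- The endomorphism `u - 1`. -/
abbrev subOne (u : LinearMap.GeneralLinearGroup F V) : Module.End F V :=
  (u : Module.End F V) - 1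

/-- The iterates of `ν ↦ u⁻¹ ν u - ν`. -/
def iterConjSub (u : LinearMap.GeneralLinearGroup F V) (ν : Module.End F V) : ℕ → Module.End F V
  | 0 => ν
  | n + 1 => (↑u⁻¹ : Module.End F V) * iterConjSub u ν n * u - iterConjSub u ν n

theorem coe_inv_mul_coe_apply (u : LinearMap.GeneralLinearGroup F V) (w : V) :
    (↑u⁻¹ : Module.End F V) ((u : Module.End F V) w) = w := by
  rw [← Module.End.mul_apply, Units.inv_mul, Module.End.one_apply]

theorem iterConjSub_mem {u : LinearMap.GeneralLinearGroup F V} {ν : Module.End F V}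
    {K : Submodule F V} (hu' : ∀ w ∈ K, (↑u⁻¹ : Module.End F V) w ∈ K) (hν : ∀ w, ν w ∈ K)
    (n : ℕ) (w : V) : iterConjSub u ν n w ∈ K := by
  induction n generalizing w with
  | zero => exact hν w
  | succ n ih => exact K.sub_mem (hu' _ (ih _)) (ih _)

theorem iterConjSub_eq_zero {u : LinearMap.GeneralLinearGroup F V} {ν : Module.End F V}
    {K : Submodule F V} (hu : ∀ w ∈ K, (u : Module.End F V) w ∈ K) (hν : ∀ w ∈ K, ν w = 0)
    (n : ℕ) (w : V) (hw : w ∈ K) : iterConjSub u ν n w = 0 := by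
  induction n generalizing w with
  | zero => exact hν w hw
  | succ n ih => simp [iterConjSub, ih w hw, ih _ (hu w hw)]

/-- Each iterate `d` maps `V` into `K` and kills `K`, so `d² = 0` and `d u⁻¹ d = 0`. Hence `(1 - d)
u⁻¹ (1 + d) u = 1 + u⁻¹ d u - d`. -/
theorem coe_iterComm {u x : LinearMap.GeneralLinearGroup F V} {ν : Module.End F V}
    {K : Submodule F V} (hu : ∀ w ∈ K, (u : Module.End F V) w ∈ K)
    (hu' : ∀ w ∈ K, (↑u⁻¹ : Module.End F V) w ∈ K) (hν : ∀ w, ν w ∈ K)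
    (hν' : ∀ w ∈ K, ν w = 0) (hx : (x : Module.End F V) = 1 + ν) (n : ℕ) :
    ((iterComm x u n : LinearMap.GeneralLinearGroup F V) : Module.End F V) = 1 + iterConjSub u ν n := by
  induction n with
  | zero => exact hx
  | succ n ih =>
    have h0 : ∀ w, iterConjSub u ν n ((↑u⁻¹ : Module.End F V) (iterConjSub u ν n w)) = 0 :=
      fun w => iterConjSub_eq_zero hu hν' n _ (hu' _ (iterConjSub_mem hu' hν n w))
    have h1 : iterConjSub u ν n * iterConjSub u ν n = 0 := LinearMap.ext fun w =>
      iterConjSub_eq_zero hu hν' n _ (iterConjSub_mem hu' hν n w)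
    have hinv : (↑(iterComm x u n)⁻¹ : Module.End F V) = 1 - iterConjSub u ν n := by
      refine Units.inv_eq_of_mul_eq_one_right ?_
      rw [ih, mul_sub, mul_one, add_mul, h1]
      simp
    ext w
    simp only [iterComm, iterConjSub, Units.val_mul, hinv, ih, Module.End.mul_apply,
      LinearMap.add_apply, LinearMap.sub_apply, Module.End.one_apply, map_add,
      coe_inv_mul_coe_apply, h0]
    abel

/-- Here `u⁻¹ ν = ν`, so each iteration is right multiplication by `u - 1`. -/
theorem iterConjSub_eq_mul_pow {u : LinearMap.GeneralLinearGroup F V} {ν : Module.End F V}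
    (hν : subOne u * ν = 0) (n : ℕ) :
    iterConjSub u ν n = ν * subOne u ^ n := by
  have h : (↑u⁻¹ : Module.End F V) * ν = ν := by
    rw [subOne, sub_mul, one_mul, sub_eq_zero] at hν
    nth_rw 1 [← hν]
    rw [Units.inv_mul_cancel_left]
  induction n with
  | zero => simp [iterConjSub]
  | succ n ih => rw [iterConjSub, ih, ← mul_assoc, h, pow_succ, mul_assoc, ← mul_sub,
      ← mul_sub_one]

/-- Here `ν u = ν`, so each iteration is left multiplication by `u⁻¹ - 1`. -/
theorem iterConjSub_eq_pow_mul {u : LinearMap.GeneralLinearGroup F V} {ν : Module.End F V}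
    (hν : ν * subOne u = 0) (n : ℕ) :
    iterConjSub u ν n = ((↑u⁻¹ : Module.End F V) - 1) ^ n * ν := by
  rw [subOne, mul_sub, mul_one, sub_eq_zero] at hν
  induction n with
  | zero => simp [iterConjSub]
  | succ n ih => rw [iterConjSub, ih, pow_succ', mul_assoc, mul_assoc, hν, mul_assoc, sub_mul,
      one_mul]

variable {L : Set (Submodule F V)} {hL : IsSeries L}

theorem exists_stabilityGroup_coe_eq_one_add {ν : Module.End F V} (hν : ν * ν = 0)
    (h : ∀ B T, IsJump L B T → ∀ w ∈ T, ν w ∈ B) : ∃ x : stabilityGroup hL,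
      ((x : LinearMap.GeneralLinearGroup F V) : Module.End F V) = 1 + ν := by
  refine ⟨⟨⟨1 + ν, 1 - ν, ?_, ?_⟩, ?_⟩, rfl⟩
  · rw [mul_sub, mul_one, add_mul, hν]; simp
  · rw [mul_add, mul_one, sub_mul, hν]; simp
  · intro B T hJ
    rw [Submodule.map_le_iff_le_comap]
    intro w hw
    simpa using h B T hJ w hw

theorem coe_iterComm_stabilityGroup (x g : stabilityGroup hL) (n : ℕ) :
    ((iterComm x g n : stabilityGroup hL) : LinearMap.GeneralLinearGroup F V) =
      iterComm (x : LinearMap.GeneralLinearGroup F V) (g : LinearMap.GeneralLinearGroup F V) n := by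
  induction n with
  | zero => rfl
  | succ n ih => simp [iterComm, ih]

theorem IsLeftEngel.exists_iterConjSub_eq_zero {g : stabilityGroup hL} (hg : IsLeftEngel g)
    {ν : Module.End F V} {K : Submodule F V}
    (hu : ∀ w ∈ K, ((g : LinearMap.GeneralLinearGroup F V) : Module.End F V) w ∈ K)
    (hu' : ∀ w ∈ K, (↑(g : LinearMap.GeneralLinearGroup F V)⁻¹ : Module.End F V) w ∈ K)
    (hν : ∀ w, ν w ∈ K) (hν' : ∀ w ∈ K, ν w = 0)
    (h : ∀ B T, IsJump L B T → ∀ w ∈ T, ν w ∈ B) :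
    ∃ n, iterConjSub (g : LinearMap.GeneralLinearGroup F V) ν n = 0 := by
  obtain ⟨x, hx⟩ := exists_stabilityGroup_coe_eq_one_add (hL := hL)
    (LinearMap.ext fun w => hν' _ (hν w)) h
  obtain ⟨n, hn⟩ := hg x
  refine ⟨n, ?_⟩
  have h1 := coe_iterComm hu hu' hν hν' hx n
  rw [← coe_iterComm_stabilityGroup, hn] at h1
  simpa using h1

theorem IsJump.sub_one_apply_mem {B T : Submodule F V} (hJ : IsJump L B T) (g : stabilityGroup hL)
    {w : V} (hw : w ∈ T) :
    subOne (g : LinearMap.GeneralLinearGroup F V) w ∈ B :=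
  g.2 B T hJ (Submodule.mem_map_of_mem hw)

theorem IsSeries.exists_jump_of_mem (hL : IsSeries L) {T : Submodule F V} (hT : T ∈ L) {w : V}
    (hw : w ∈ T) (hw0 : w ≠ 0) : ∃ B' T', IsJump L B' T' ∧ T' ≤ T ∧ w ∈ T' ∧ w ∉ B' := by
  obtain ⟨B', T', hJ, -, hwT', hwB'⟩ := hL.exists_jump hL.bot_mem (w := w) (by simpa)
  refine ⟨B', T', hJ, ?_, hwT', hwB'⟩
  rcases hL.chain.total hT hJ.top_mem with h | h
  · rcases hL.chain.total hT hJ.bot_mem with h' | h'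
    · exact absurd (h' hw) hwB'
    · rcases hJ.eq_or_eq T hT h' h with rfl | rfl
      · exact absurd hw hwB'
      · exact le_rfl
  · exact h

theorem sub_one_apply_mem (g : stabilityGroup hL) {T : Submodule F V} (hT : T ∈ L) {w : V}
    (hw : w ∈ T) : subOne (g : LinearMap.GeneralLinearGroup F V) w ∈ T := by
  by_cases hw0 : w = 0
  · simp [hw0]
  obtain ⟨B', T', hJ, hle, hw', -⟩ := hL.exists_jump_of_mem hT hw hw0
  exact hle (hJ.lt.le (hJ.sub_one_apply_mem g hw'))

theorem coe_apply_mem (g : stabilityGroup hL) {T : Submodule F V} (hT : T ∈ L) {w : V}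
    (hw : w ∈ T) : ((g : LinearMap.GeneralLinearGroup F V) : Module.End F V) w ∈ T := by
  simpa using T.add_mem (sub_one_apply_mem g hT hw) hw

theorem coe_inv_apply_mem (g : stabilityGroup hL) {T : Submodule F V} (hT : T ∈ L) {w : V}
    (hw : w ∈ T) : (↑(g : LinearMap.GeneralLinearGroup F V)⁻¹ : Module.End F V) w ∈ T :=
  coe_apply_mem g⁻¹ hT hw

theorem sub_one_pow_apply_mem (g : stabilityGroup hL) {T : Submodule F V} (hT : T ∈ L) {w : V}
    (hw : w ∈ T) (n : ℕ) :
    (subOne (g : LinearMap.GeneralLinearGroup F V) ^ n) w ∈ T := by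
  induction n with
  | zero => simpa
  | succ n ih => rw [pow_succ']; exact sub_one_apply_mem g hT ih

/-- If `ν` maps `V` into a member `K` of the series and kills `K`, then the iterates of
`ν ↦ g⁻¹ ν g - ν` reach zero for a left Engel element `g`. -/
theorem IsLeftEngel.exists_iterConjSub_eq_zero_of_mem {g : stabilityGroup hL} (hg : IsLeftEngel g)
    {ν : Module.End F V} {K : Submodule F V} (hK : K ∈ L) (hν : ∀ w, ν w ∈ K)
    (hν' : ∀ w ∈ K, ν w = 0) :
    ∃ n, iterConjSub (g : LinearMap.GeneralLinearGroup F V) ν n = 0 := by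
  refine hg.exists_iterConjSub_eq_zero (fun w => coe_apply_mem g hK)
    (fun w => coe_inv_apply_mem g hK) hν hν' fun B T hJ w hw => ?_
  rcases hL.chain.total hK hJ.bot_mem with h | h
  · exact h (hν w)
  rcases hL.chain.total hJ.top_mem hK with h' | h'
  · rw [hν' w (h' hw)]
    exact B.zero_mem
  rcases hJ.eq_or_eq K hK h h' with rfl | rfl
  · exact hν w
  · rw [hν' w hw]
    exact B.zero_mem

/-- A left Engel element of the stability group is unipotent on `V / T` if `T` is the upper
term of a jump. -/
theorem IsLeftEngel.exists_pow_apply_mem {g : stabilityGroup hL} (hg : IsLeftEngel g)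
    {B T : Submodule F V} (hJ : IsJump L B T) :
    ∃ n, ∀ w, (subOne (g : LinearMap.GeneralLinearGroup F V) ^ n) w ∈ T := by
  set h : Module.End F V := subOne (g : LinearMap.GeneralLinearGroup F V) with hh
  by_contra! hcon
  obtain ⟨φ, hφ⟩ := exists_dual_forall_exists_apply_ne_zero
    (W := fun n => (LinearMap.range (h ^ n)).map T.mkQ) (by
      refine antitone_nat_of_succ_le fun n => Submodule.map_mono ?_
      rintro _ ⟨w, rfl⟩
      exact ⟨h w, by rw [pow_succ]; rfl⟩) (fun n hbot => by
      obtain ⟨w, hw⟩ := hcon n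
      have : T.mkQ ((h ^ n) w) ∈ (LinearMap.range (h ^ n)).map T.mkQ :=
        Submodule.mem_map_of_mem ⟨w, rfl⟩
      rw [hbot, Submodule.mem_bot] at this
      exact hw (by simpa using this))
  obtain ⟨v, hvT, hvB⟩ := SetLike.exists_of_lt hJ.lt
  let ψ : Module.Dual F V := φ ∘ₗ T.mkQ
  obtain ⟨n, hn⟩ := hg.exists_iterConjSub_eq_zero_of_mem (ν := ψ.smulRight v) hJ.top_mem
    (fun w => T.smul_mem _ hvT) (fun w hw => by
      have : T.mkQ w = 0 := by simpa using hw
      simp only [LinearMap.smulRight_apply, ψ, LinearMap.comp_apply, this, map_zero, zero_smul])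
  -- Modulo `B` the vector `v` is fixed by `g⁻¹`, so only the functional changes: `ψ` becomes `ψ ∘
  -- hⁿ`.
  have key : ∀ n w, iterConjSub (g : LinearMap.GeneralLinearGroup F V) (ψ.smulRight v) n w
      - ψ ((h ^ n) w) • v ∈ B := by
    intro n
    induction n with
    | zero => intro w; simp [iterConjSub]
    | succ n ih =>
      intro w
      set d := iterConjSub (g : LinearMap.GeneralLinearGroup F V) (ψ.smulRight v) n
      set u := (g : LinearMap.GeneralLinearGroup F V)
      have h1 : (↑u⁻¹ : Module.End F V) (d ((u : Module.End F V) w)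
        - ψ ((h ^ n) ((u : Module.End F V) w)) • v) ∈ B := coe_inv_apply_mem g hJ.bot_mem (ih _)
      have h2 : (↑u⁻¹ : Module.End F V) v - v ∈ B := hJ.sub_one_apply_mem g⁻¹ hvT
      have h3 := B.sub_mem (B.add_mem h1
        (B.smul_mem (ψ ((h ^ n) ((u : Module.End F V) w))) h2)) (ih w)
      have h4 : (h ^ (n + 1)) w = (h ^ n) ((u : Module.End F V) w) - (h ^ n) w := by
        rw [pow_succ, Module.End.mul_apply, hh, subOne, LinearMap.sub_apply, map_sub]; rfl
      convert h3 using 1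
      rw [h4]
      simp only [iterConjSub, LinearMap.sub_apply, Module.End.mul_apply, map_sub, map_smul,
        sub_smul, smul_sub]
      abel
  obtain ⟨_, ⟨_, ⟨w, rfl⟩, rfl⟩, hw⟩ := hφ n
  have h1 := key n w
  rw [hn, LinearMap.zero_apply, zero_sub, B.neg_mem_iff] at h1
  exact hvB ((B.smul_mem_iff hw).1 h1)

end Unipotent

/-! ### Local nilpotence of `g - 1`, then nilpotence -/

section Engel

variable {F V : Type*} [Field F] [AddCommGroup V] [Module F V]
  {L : Set (Submodule F V)} {hL : IsSeries L}

/-- `u - 1 = -u (u⁻¹ - 1)` with commuting factors, the first invertible. -/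
theorem sub_one_pow_apply_eq_zero_iff (u : LinearMap.GeneralLinearGroup F V) (n : ℕ) (w : V) :
    (((↑u⁻¹ : Module.End F V) - 1) ^ n) w = 0 ↔ (subOne u ^ n) w = 0 := by
  have h : subOne u = (-(u : Module.End F V)) * ((↑u⁻¹ : Module.End F V) - 1) := by
    rw [mul_sub, neg_mul, Units.mul_inv, subOne]; simp [sub_eq_add_neg, add_comm]
  have hc : Commute (-(u : Module.End F V)) ((↑u⁻¹ : Module.End F V) - 1) :=
    Commute.neg_left (Commute.sub_right (by rw [Commute, SemiconjBy, Units.mul_inv, Units.inv_mul])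
      (Commute.one_right _))
  rw [h, hc.mul_pow, Module.End.mul_apply]
  constructor
  · intro h
    rw [h, map_zero]
  · intro h
    have hinj : Function.Injective ((-(u : Module.End F V)) ^ n) := by
      rw [← Units.val_neg, ← Units.val_pow_eq_pow_val]
      exact Function.LeftInverse.injective (coe_inv_mul_coe_apply _)
    exact hinj (by rw [h, map_zero])

/-- For a left Engel element `g` of the stability group, `g - 1` is locally nilpotent. -/
theorem IsLeftEngel.exists_sub_one_pow_apply_eq_zero {g : stabilityGroup hL} (hg : IsLeftEngel g)
    (v : V) :
    ∃ n, (subOne (g : LinearMap.GeneralLinearGroup F V) ^ n) v = 0 := by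
  set h : Module.End F V := subOne (g : LinearMap.GeneralLinearGroup F V) with hh
  by_contra! hv
  obtain ⟨B, T, hJ, -, -, hvB⟩ := hL.exists_jump_of_mem hL.top_mem Submodule.mem_top (hv 0)
  obtain ⟨n, hn⟩ := hg.exists_pow_apply_mem hJ
  have hnB : ∀ w, (h ^ (n + 1)) w ∈ B := fun w => by
    rw [pow_succ']
    exact hJ.sub_one_apply_mem g (hn w)
  -- Otherwise `V = hᵏV + B` for all `k`; as `hⁿ⁺¹V ≤ B`, this gives `V = B`, against `v ∉ B`.
  have hne : LinearMap.range h ⊔ B ≠ ⊤ := by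
    intro htop
    have hk : ∀ k w, ∃ w', w - (h ^ k) w' ∈ B := by
      intro k
      induction k with
      | zero => exact fun w => ⟨w, by simp⟩
      | succ k ih =>
        intro w
        obtain ⟨w', hw'⟩ := ih w
        obtain ⟨_, ⟨y, rfl⟩, b, hb, rfl⟩ := Submodule.mem_sup.1 (htop ▸ Submodule.mem_top (x := w'))
        refine ⟨y, ?_⟩
        convert B.add_mem hw' (sub_one_pow_apply_mem g hJ.bot_mem hb k) using 1
        rw [map_add, pow_succ, Module.End.mul_apply]
        abel
    obtain ⟨w', hw'⟩ := hk (n + 1) v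
    exact hvB (by simpa using B.add_mem hw' (hnB w'))
  obtain ⟨w, hw⟩ : ∃ w, w ∉ LinearMap.range h ⊔ B := by
    by_contra! hall
    exact hne (eq_top_iff.2 fun w _ => hall w)
  obtain ⟨φ, hφw, hφ⟩ := Submodule.exists_le_ker_of_notMem hw
  -- As `φ` kills `hV`, `ν h = 0`; evaluating the `m`-th iterate at `w` then forces `hᵐ⁺ⁿ⁺¹ v = 0`.
  obtain ⟨m, hm⟩ := hg.exists_iterConjSub_eq_zero_of_mem
    (ν := φ.smulRight ((h ^ (n + 1)) v)) hJ.bot_mem (fun w => B.smul_mem _ (hnB v)) fun w hw => by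
      rw [LinearMap.smulRight_apply, show φ w = 0 from hφ (Submodule.mem_sup_right hw), zero_smul]
  rw [iterConjSub_eq_pow_mul (LinearMap.ext fun w => by
    rw [Module.End.mul_apply, LinearMap.smulRight_apply,
      show φ _ = 0 from hφ (Submodule.mem_sup_left ⟨w, rfl⟩), zero_smul, LinearMap.zero_apply])]
    at hm
  have h1 := LinearMap.congr_fun hm w
  rw [Module.End.mul_apply, LinearMap.smulRight_apply, map_smul, LinearMap.zero_apply,
    smul_eq_zero, or_iff_right hφw, sub_one_pow_apply_eq_zero_iff, ← hh,
    ← Module.End.mul_apply, ← pow_add] at h1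
  exact hv _ h1

/-- For any two nonzero vectors there is a nonzero member of the series that contains neither, if
no jump has lower term `0`. -/
theorem IsSeries.exists_ne_bot_of_ne_zero (hL : IsSeries L) (h0 : ∀ T, ¬ IsJump L ⊥ T) {u w : V}
    (hu : u ≠ 0) (hw : w ≠ 0) : ∃ B ∈ L, B ≠ ⊥ ∧ u ∉ B ∧ w ∉ B := by
  obtain ⟨B, T, hJ, -, -, huB⟩ := hL.exists_jump_of_mem hL.top_mem Submodule.mem_top hu
  obtain ⟨B', T', hJ', -, -, hwB⟩ := hL.exists_jump_of_mem hL.top_mem Submodule.mem_top hw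
  rcases hL.chain.total hJ.bot_mem hJ'.bot_mem with h | h
  · exact ⟨B, hJ.bot_mem, fun e => h0 T (e ▸ hJ), huB, fun hB => hwB (h hB)⟩
  · exact ⟨B', hJ'.bot_mem, fun e => h0 T' (e ▸ hJ'), fun hB => huB (h hB), hwB⟩

/-- Choose `y` with `h²ⁱ y ≠ 0` and a nonzero `B` omitting `u` and `h²ⁱ y`. If `hⁱ y ∈ ker hⁱ + B`,
then `h²ⁱ y ∈ hⁱB ≤ B`. The vector `v` is the last nonzero iterate of a nonzero element of `B`. -/
theorem exists_mem_series_of_locally_nilpotent {g : stabilityGroup hL}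
    (h0 : ∀ T, ¬ IsJump L ⊥ T)
    (hloc : ∀ v, ∃ n, (subOne (g : LinearMap.GeneralLinearGroup F V) ^ n) v = 0)
    (hnil : ∀ n, subOne (g : LinearMap.GeneralLinearGroup F V) ^ n ≠ 0) (i : ℕ) {u : V}
    (hu : u ≠ 0) : ∃ (B : Submodule F V) (v y : V), B ∈ L ∧ u ∉ B ∧
      v ∈ B ∧ v ≠ 0 ∧ subOne (g : LinearMap.GeneralLinearGroup F V) v = 0 ∧
      (subOne (g : LinearMap.GeneralLinearGroup F V) ^ i) y ∉
        LinearMap.ker (subOne (g : LinearMap.GeneralLinearGroup F V) ^ i) ⊔ B := by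
  set h : Module.End F V := subOne (g : LinearMap.GeneralLinearGroup F V) with hh
  obtain ⟨y, hy⟩ : ∃ y, (h ^ (i + i)) y ≠ 0 := by
    by_contra! hall
    exact hnil _ (LinearMap.ext hall)
  obtain ⟨B, hB, hBne, huB, hyB⟩ := hL.exists_ne_bot_of_ne_zero h0 hu hy
  obtain ⟨v, hvB, hv0, hv⟩ : ∃ v ∈ B, v ≠ 0 ∧ h v = 0 := by
    obtain ⟨b, hb, hb0⟩ := Submodule.exists_mem_ne_zero_of_ne_bot hBne
    classical
    have hn := Nat.find_spec (hloc b)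
    have hmin := fun m => Nat.find_min (hloc b) (m := m)
    rcases hk : Nat.find (hloc b) with _ | k
    · rw [hk] at hn
      exact absurd hn hb0
    · rw [hk] at hn hmin
      exact ⟨(h ^ k) b, sub_one_pow_apply_mem g hB hb k, hmin k (Nat.lt_succ_self k), by
        rw [pow_succ'] at hn; exact hn⟩
  refine ⟨B, v, y, hB, huB, hvB, hv0, hv, fun hmem => hyB ?_⟩
  obtain ⟨k, hk, b, hb, e⟩ := Submodule.mem_sup.1 hmem
  rw [pow_add, Module.End.mul_apply, ← e, map_add, LinearMap.mem_ker.1 hk, zero_add]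
  exact sub_one_pow_apply_mem g hB hb i

theorem exists_seq_of_locally_nilpotent {g : stabilityGroup hL}
    (h0 : ∀ T, ¬ IsJump L ⊥ T)
    (hloc : ∀ v, ∃ n, (subOne (g : LinearMap.GeneralLinearGroup F V) ^ n) v = 0)
    (hnil : ∀ n, subOne (g : LinearMap.GeneralLinearGroup F V) ^ n ≠ 0) :
    ∃ (B : ℕ → Submodule F V) (v y : ℕ → V), (∀ i, B i ∈ L) ∧ (∀ i, v i ∈ B i) ∧
      (∀ i, v i ∉ B (i + 1)) ∧
      (∀ i, subOne (g : LinearMap.GeneralLinearGroup F V) (v i) = 0) ∧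
      ∀ i, (subOne (g : LinearMap.GeneralLinearGroup F V) ^ (i + 1)) (y i) ∉
        LinearMap.ker (subOne (g : LinearMap.GeneralLinearGroup F V) ^ (i + 1)) ⊔ B i := by
  choose! B v y hBL huB hvB hv0 hv hy using fun (i : ℕ) (u : V) (hu : u ≠ 0) =>
    exists_mem_series_of_locally_nilpotent h0 hloc hnil (i + 1) hu
  obtain ⟨u, hu⟩ : ∃ u : V, u ≠ 0 := by
    by_contra! hall
    exact hnil 0 (LinearMap.ext fun w => by simp [hall w])
  -- The vector to be omitted at each stage is the `v` of the previous stage.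
  let s : ℕ → V := fun i => Nat.rec u (fun i s => v i s) i
  have hs : ∀ i, s i ≠ 0 := by
    intro i
    induction i with
    | zero => exact hu
    | succ i ih => exact hv0 i _ ih
  exact ⟨fun i => B i (s i), fun i => s (i + 1), fun i => y i (s i), fun i => hBL _ _ (hs i),
    fun i => hvB _ _ (hs i), fun i => huB _ _ (hs (i + 1)), fun i => hv _ _ (hs i),
    fun i => hy _ _ (hs i)⟩

/-- A pointwise finite family of functionals is a linear map to the finitely supported
functions. -/
theorem exists_finsupp_apply_eq (φ : ℕ → Module.Dual F V)
    (hφ : ∀ w, {i | φ i w ≠ 0}.Finite) : ∃ c : V →ₗ[F] (ℕ →₀ F), ∀ w i, c w i = φ i w :=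
  ⟨{ toFun := fun w => Finsupp.ofSupportFinite (fun i => φ i w) (hφ w)
     map_add' := fun w w' => by ext i; exact map_add (φ i) w w'
     map_smul' := fun a w => by ext i; exact map_smul (φ i) a w },
    fun w i => rfl⟩

/-- A left Engel element of the stability group is unipotent. -/
theorem IsLeftEngel.isUnipotentElement {g : stabilityGroup hL} (hg : IsLeftEngel g) :
    IsUnipotentElement (g : LinearMap.GeneralLinearGroup F V) := by
  by_cases h0 : ∃ T, IsJump L ⊥ T
  · obtain ⟨T, hJ⟩ := h0
    obtain ⟨n, hn⟩ := hg.exists_pow_apply_mem hJ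
    refine ⟨n + 1, LinearMap.ext fun w => ?_⟩
    have := hJ.sub_one_apply_mem g (hn w)
    rw [pow_succ']
    simpa using this
  push Not at h0
  by_contra hnu
  have hloc := hg.exists_sub_one_pow_apply_eq_zero
  have hnil : ∀ n, subOne (g : LinearMap.GeneralLinearGroup F V) ^ n ≠ 0 := fun n hn =>
    hnu ⟨n, hn⟩
  obtain ⟨B, v, y, hBL, hvB, hvB', hv, hy⟩ := exists_seq_of_locally_nilpotent h0 hloc hnil
  set h : Module.End F V := subOne (g : LinearMap.GeneralLinearGroup F V) with hh
  have hanti : Antitone B := antitone_nat_of_succ_le fun i =>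
    (hL.chain.total (hBL (i + 1)) (hBL i)).resolve_right fun hle => hvB' i (hle (hvB i))
  have hli := linearIndependent_of_notMem_succ hanti hvB hvB'
  choose φ hφy hφ using fun i => Submodule.exists_le_ker_of_notMem (hy i)
  have hφker : ∀ i w, (h ^ (i + 1)) w = 0 → φ i w = 0 := fun i w hw =>
    hφ i (Submodule.mem_sup_left hw)
  have hφB : ∀ i, ∀ w ∈ B i, φ i w = 0 := fun i w hw => hφ i (Submodule.mem_sup_right hw)
  -- `φ i` kills `ker hⁱ⁺¹`, so local nilpotence makes the sum defining `ν` pointwise finite.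
  obtain ⟨c, hc⟩ := exists_finsupp_apply_eq φ fun w => by
    obtain ⟨n, hn⟩ := hloc w
    refine (Set.finite_Iio n).subset fun i hi => ?_
    by_contra hle
    refine hi (hφker i w ?_)
    obtain ⟨k, hk⟩ := Nat.exists_eq_add_of_le (show n ≤ i + 1 by simp at hle; omega)
    rw [hk, add_comm, pow_add, Module.End.mul_apply, hn, map_zero]
  let ν : Module.End F V := Finsupp.linearCombination F v ∘ₗ c
  have hνmem : ∀ (K : Submodule F V) w, (∀ i, φ i w ≠ 0 → v i ∈ K) → ν w ∈ K := by
    intro K w hK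
    refine K.sum_mem fun i hi => K.smul_mem _ (hK i ?_)
    rw [← hc]
    exact Finsupp.mem_support_iff.1 hi
  have hνker : ∀ w, ν w ∈ LinearMap.ker h := fun w => hνmem _ _ fun i _ => hv i
  have hφ1 : ∀ w, h w = 0 → ∀ i, φ i w = 0 := fun w hw i =>
    hφker i w (by rw [pow_succ, Module.End.mul_apply, hw, map_zero])
  have hfix : ∀ w, h w = 0 →
      ((g : LinearMap.GeneralLinearGroup F V) : Module.End F V) w = w := fun w hw => by
    rwa [hh, LinearMap.sub_apply, sub_eq_zero] at hw
  obtain ⟨n, hn⟩ := hg.exists_iterConjSub_eq_zero (ν := ν) (K := LinearMap.ker h)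
    (fun w hw => by rwa [hfix w hw])
    (fun w hw => by
      have := coe_inv_mul_coe_apply (g : LinearMap.GeneralLinearGroup F V) w
      rw [hfix w hw] at this
      rwa [this])
    hνker
    (fun w hw => (Submodule.mem_bot F).1
      (hνmem ⊥ w fun i hi => absurd (hφ1 w hw i) hi))
    -- If `φ i w ≠ 0` with `w ∈ T`, then `T` is not inside `B i`, so `B i ≤ C` because `(C, T)` is a
    -- jump; hence `v i ∈ C`.
    (fun C T hJ w hw => hνmem _ _ fun i hi => by
      have hTB : ¬ T ≤ B i := fun hle => hi (hφB i w (hle hw))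
      have hBT := (hL.chain.total hJ.top_mem (hBL i)).resolve_left hTB
      rcases hL.chain.total (hBL i) hJ.bot_mem with h1 | h1
      · exact h1 (hvB i)
      · rcases hJ.eq_or_eq _ (hBL i) h1 hBT with h2 | h2
        · exact h2 ▸ hvB i
        · exact absurd h2.ge hTB)
  rw [iterConjSub_eq_mul_pow (LinearMap.ext hνker)] at hn
  -- The exponent is `n + 1` because `φ n` was chosen nonzero at `hⁿ⁺¹ (y n)`; independence of the
  -- `v i` gives the contradiction.
  have h1 : ν ((h ^ (n + 1)) (y n)) = 0 := by
    rw [pow_succ, Module.End.mul_apply]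
    exact LinearMap.congr_fun hn (h (y n))
  have h2 : c ((h ^ (n + 1)) (y n)) = 0 := hli (by rw [map_zero]; exact h1)
  exact hφy n (by rw [← hc, h2]; rfl)

end Engel

theorem mainTheorem3 {F V : Type*} [Field F] [AddCommGroup V] [Module F V]
    {L : Set (Submodule F V)} (hL : IsSeries L) :
    (∀ g ∈ hirschPlotkinRadical (stabilityGroup hL),
      IsUnipotentElement (g : LinearMap.GeneralLinearGroup F V)) ∧
    (∀ g : stabilityGroup hL,
      ¬ IsUnipotentElement (g : LinearMap.GeneralLinearGroup F V) → ¬ IsLeftEngel g) :=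
  ⟨fun _ hg => (isLeftEngel_of_mem_hirschPlotkinRadical hg).isUnipotentElement,
    fun _ hg h => hg h.isUnipotentElement⟩
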